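/- **Choi–Jamiołkowski correspondence in arbitrary dimension.** For a complex Hilbert space $H$ let $L^{1}(H)$ be the space of trace-class operators on $H$ with the trace norm $\|s\|_1=\operatorname{tr}|s|$; "positive" means positive semi-definite, and $\otimes$ between Hilbert spaces is the Hilbert space tensor product. A linear map $\Phi:L^{1}(H_1)\to L^{1}(H_2)$ is called *completely positive* (CP) if for every $n\in\mathbb{N}$ the map $\mathrm{id}_n\otimes\Phi: L^{1}(\mathbb{C}^n\otimes H_1)\to L^{1}(\mathbb{C}^n\otimes H_2)$ sends positive operators to positive operators, and CPTP if it is CP and moreover $\operatorname{tr}\Phi(s)=\operatorname{tr}s$ for all $s\in L^{1}(H_1)$. Let $H_1$ and $H_2$ be complex Hilbert spaces of arbitrary dimension, let $(e_i)_{i\in I}$ be an orthonormal basis of $H_1$, and let $E_{ij}\in L^{1}(H_1)$ be the operator $x\mapsto\langle e_j,x\rangle e_i$, where the inner product is linear in the second argument. Let $\Phi:L^{1}(H_1)\to L^{1}(H_2)$ be a linear map that is bounded with respect to the trace norms. Consider the conditions: (a) for every finite $F\subseteq I$ the trace-class operator $C^{(F)}=\sum_{i,j\in F}E_{ij}\otimes\Phi(E_{ij})\in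 L^{1}(H_1\otimes H_2)$ is positive; (b) $\operatorname{tr}\Phi(E_{ij})=\delta_{ij}$ for all $i,j\in I$. Then $\Phi$ is CP if and only if (a) holds, and $\Phi$ is CPTP if and only if both (a) and (b) hold. -/

import Mathlib

open scoped TensorProduct ENNReal InnerProductSpace

set_option linter.unusedSectionVars false

namespace ChoiJam

universe u v w

section TraceNorm

variable {H : Type u} [NormedAddCommGroup H] [InnerProductSpace ℂ H] [CompleteSpace H]
variable {K : Type v} [NormedAddCommGroup K] [InnerProductSpace ℂ K] [CompleteSpace K]

variable (H) in
/-- The index set of a fixed orthonormal basis of `H`. -/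
noncomputable def basisIndex : Set H := (exists_hilbertBasis ℂ H).choose

variable (H) in
/-- A fixed orthonormal basis of `H`. -/
noncomputable def stdBasis : HilbertBasis (basisIndex H) ℂ H :=
  (exists_hilbertBasis ℂ H).choose_spec.choose

/-- The trace norm `tr |T| = ∑ᵢ ⟨eᵢ, |T| eᵢ⟩` with values in `[0, ∞]`, where `|T| = √(T* T)`.
It does not depend on the orthonormal basis, see `traceNorm_eq`. -/
noncomputable def traceNorm (T : H →L[ℂ] H) : ℝ≥0∞ :=
  ∑' i, ENNReal.ofReal (RCLike.re ⟪stdBasis H i, CFC.abs T (stdBasis H i)⟫_ℂ)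

/-! ### Sums of squares over orthonormal bases -/

theorem enorm_sq_eq {ι : Type*} (b : HilbertBasis ι ℂ H) (x : H) :
    ‖x‖ₑ ^ 2 = ∑' i, ‖⟪b i, x⟫_ℂ‖ₑ ^ 2 := by
  have h := b.hasSum_inner_mul_inner x x
  have h2 : HasSum (fun i => ‖⟪b i, x⟫_ℂ‖ ^ 2) (‖x‖ ^ 2) := by
    have h3 := RCLike.hasSum_re ℂ h
    convert h3 using 1
    · funext i
      rw [← inner_conj_symm x (b i), RCLike.conj_mul]
      norm_cast
    · rw [inner_self_eq_norm_sq_to_K]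
      norm_cast
  have e1 : ∀ r : ℂ, ‖r‖ₑ ^ 2 = ENNReal.ofReal (‖r‖ ^ 2) := fun r => by
    rw [ENNReal.ofReal_pow (norm_nonneg _), ofReal_norm]
  have e2 : ‖x‖ₑ ^ 2 = ENNReal.ofReal (‖x‖ ^ 2) := by
    rw [ENNReal.ofReal_pow (norm_nonneg _), ofReal_norm]
  simp_rw [e1]
  rw [e2, ← h2.tsum_eq, ENNReal.ofReal_tsum_of_nonneg (fun _ => by positivity) h2.summable]

theorem hs_adjoint {ι κ : Type*} (b : HilbertBasis ι ℂ H) (c : HilbertBasis κ ℂ K)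
    (B : H →L[ℂ] K) :
    ∑' i, ‖B (b i)‖ₑ ^ 2 = ∑' j, ‖B.adjoint (c j)‖ₑ ^ 2 := by
  calc ∑' i, ‖B (b i)‖ₑ ^ 2 = ∑' i, ∑' j, ‖⟪c j, B (b i)⟫_ℂ‖ₑ ^ 2 := by
        simp_rw [← enorm_sq_eq c]
    _ = ∑' j, ∑' i, ‖⟪c j, B (b i)⟫_ℂ‖ₑ ^ 2 := ENNReal.tsum_comm
    _ = ∑' j, ‖B.adjoint (c j)‖ₑ ^ 2 := by
        congr 1; funext j
        rw [enorm_sq_eq b]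
        congr 1; funext i
        rw [ContinuousLinearMap.adjoint_inner_right, ← inner_conj_symm, RCLike.enorm_conj]

theorem hs_basis {ι κ : Type*} (b : HilbertBasis ι ℂ H) (c : HilbertBasis κ ℂ H)
    (B : H →L[ℂ] K) :
    ∑' i, ‖B (b i)‖ₑ ^ 2 = ∑' j, ‖B (c j)‖ₑ ^ 2 := by
  rw [hs_adjoint b (stdBasis K), hs_adjoint c (stdBasis K)]

theorem hs_comp_left_le {ι : Type*} (b : HilbertBasis ι ℂ H) {L : Type*} [NormedAddCommGroup L]
    [InnerProductSpace ℂ L] (C : K →L[ℂ] L) (B : H →L[ℂ] K) :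
    ∑' i, ‖C (B (b i))‖ₑ ^ 2 ≤ ‖C‖ₑ ^ 2 * ∑' i, ‖B (b i)‖ₑ ^ 2 := by
  rw [← ENNReal.tsum_mul_left]
  refine ENNReal.tsum_le_tsum fun i => ?_
  rw [← mul_pow]
  gcongr
  exact C.le_opENorm _

theorem hs_comp_right_le {ι κ : Type*} (b : HilbertBasis ι ℂ H) {L : Type*}
    [NormedAddCommGroup L] [InnerProductSpace ℂ L] [CompleteSpace L]
    (c : HilbertBasis κ ℂ K) (C : K →L[ℂ] L) (B : H →L[ℂ] K) :
    ∑' i, ‖C (B (b i))‖ₑ ^ 2 ≤ ‖B‖ₑ ^ 2 * ∑' j, ‖C (c j)‖ₑ ^ 2 := by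
  have h1 := hs_adjoint b (stdBasis L) (C ∘L B)
  have h2 := hs_comp_left_le (stdBasis L) B.adjoint C.adjoint
  rw [← hs_adjoint c (stdBasis L)] at h2
  have h3 : ‖B.adjoint‖ₑ = ‖B‖ₑ := by
    rw [← ofReal_norm, ← ofReal_norm, LinearIsometryEquiv.norm_map]
  rw [h3] at h2
  refine le_trans (le_of_eq ?_) h2
  simpa [ContinuousLinearMap.adjoint_comp] using h1

/-! ### Absolute value and polar decomposition -/

theorem inner_abs (T : H →L[ℂ] H) (x y : H) :
    ⟪CFC.abs T x, CFC.abs T y⟫_ℂ = ⟪T x, T y⟫_ℂ := by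
  have h : IsSelfAdjoint (CFC.abs T) := (CFC.abs_nonneg T).isSelfAdjoint
  have h2 := CFC.abs_mul_abs T
  have h3 : CFC.abs T (CFC.abs T y) = T.adjoint (T y) := by
    have := congrArg (fun S : H →L[ℂ] H => S y) h2
    simpa [ContinuousLinearMap.star_eq_adjoint] using this
  have h4 : (CFC.abs T).adjoint = CFC.abs T := h
  calc ⟪CFC.abs T x, CFC.abs T y⟫_ℂ = ⟪x, (CFC.abs T).adjoint (CFC.abs T y)⟫_ℂ := by
        rw [ContinuousLinearMap.adjoint_inner_right]
    _ = _ := by rw [h4, h3, ContinuousLinearMap.adjoint_inner_right]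

theorem norm_abs_apply (T : H →L[ℂ] H) (x : H) : ‖CFC.abs T x‖ = ‖T x‖ := by
  rw [@norm_eq_sqrt_re_inner ℂ, @norm_eq_sqrt_re_inner ℂ _ _ _ _ (T x), inner_abs]

theorem exists_polar (T : H →L[ℂ] H) :
    ∃ U : H →L[ℂ] H, ‖U‖ ≤ 1 ∧ T = U ∘L CFC.abs T ∧ CFC.abs T = U.adjoint ∘L T := by
  set A := CFC.abs T with hA
  let S : Submodule ℂ H := A.range.topologicalClosure
  have : CompleteSpace S := (Submodule.isClosed_topologicalClosure _).completeSpace_coe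
  have hmem : ∀ x, A x ∈ S := fun x => Submodule.le_topologicalClosure _ ⟨x, rfl⟩
  let e : H →ₗ[ℂ] S := (A : H →ₗ[ℂ] H).codRestrict S hmem
  have he : DenseRange e := by
    intro y
    have hy : (y : H) ∈ closure (A.range : Set H) := y.2
    rw [Metric.mem_closure_iff] at hy ⊢
    intro ε hε
    obtain ⟨_, ⟨x, rfl⟩, hx⟩ := hy ε hε
    exact ⟨e x, ⟨x, rfl⟩, hx⟩
  have hn : ∀ x, ‖(T : H →ₗ[ℂ] H) x‖ ≤ 1 * ‖e x‖ := by
    intro x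
    rw [one_mul]
    exact (norm_abs_apply T x).ge
  let W : S →L[ℂ] H := (T : H →ₗ[ℂ] H).extendOfNorm e
  have hW : ‖W‖ ≤ 1 := LinearMap.opNorm_extendOfNorm_le he zero_le_one hn
  have hWe : ∀ x, W (e x) = T x := LinearMap.extendOfNorm_eq he ⟨1, hn⟩
  let U : H →L[ℂ] H := W ∘L S.orthogonalProjectionOnto
  have hU1 : ‖U‖ ≤ 1 := by
    refine (ContinuousLinearMap.opNorm_comp_le _ _).trans ?_
    exact mul_le_one₀ hW (norm_nonneg _) (Submodule.orthogonalProjectionOnto_norm_le _)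
  have hUA : ∀ x, U (A x) = T x := by
    intro x
    have : S.orthogonalProjectionOnto (A x) = e x :=
      Submodule.orthogonalProjectionOnto_mem_subspace_eq_self (e x)
    simp only [U, ContinuousLinearMap.comp_apply, this, hWe]
  refine ⟨U, hU1, ?_, ?_⟩
  · ext x; exact (hUA x).symm
  · ext x
    rw [ContinuousLinearMap.comp_apply]
    have h1 : ‖U.adjoint (T x)‖ ≤ ‖T x‖ := by
      refine (ContinuousLinearMap.le_opNorm _ _).trans ?_
      rw [LinearIsometryEquiv.norm_map]
      exact mul_le_of_le_one_left (norm_nonneg _) hU1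
    have h2 : RCLike.re ⟪U.adjoint (T x), A x⟫_ℂ = ‖T x‖ ^ 2 := by
      rw [ContinuousLinearMap.adjoint_inner_left, hUA, inner_self_eq_norm_sq]
    have h3 : ‖U.adjoint (T x) - A x‖ ^ 2 ≤ 0 := by
      rw [@norm_sub_sq ℂ, h2, norm_abs_apply T x]
      nlinarith [norm_nonneg (U.adjoint (T x)), norm_nonneg (T x)]
    have h4 : U.adjoint (T x) - A x = 0 := by
      rw [← norm_eq_zero]; nlinarith [norm_nonneg (U.adjoint (T x) - A x)]
    exact (sub_eq_zero.mp h4).symm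

theorem exists_sqrt_abs (T : H →L[ℂ] H) :
    ∃ R : H →L[ℂ] H, R.adjoint = R ∧ R ∘L R = CFC.abs T := by
  refine ⟨CFC.sqrt (CFC.abs T), ?_, ?_⟩
  · exact (CFC.sqrt_nonneg (CFC.abs T)).isSelfAdjoint
  · exact CFC.sqrt_mul_sqrt_self (CFC.abs T) (CFC.abs_nonneg T)

theorem ofReal_inner_sqrt {T R : H →L[ℂ] H} (h1 : R.adjoint = R) (h2 : R ∘L R = CFC.abs T)
    (x : H) : ENNReal.ofReal (RCLike.re ⟪x, CFC.abs T x⟫_ℂ) = ‖R x‖ₑ ^ 2 := by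
  have : ⟪x, CFC.abs T x⟫_ℂ = ⟪R x, R x⟫_ℂ := by
    rw [← h2, ContinuousLinearMap.comp_apply]
    conv_lhs => rw [← h1]
    rw [ContinuousLinearMap.adjoint_inner_right, h1]
  rw [this, inner_self_eq_norm_sq, ENNReal.ofReal_pow (norm_nonneg _), ofReal_norm]

theorem traceNorm_eq_hs {T R : H →L[ℂ] H} (h1 : R.adjoint = R) (h2 : R ∘L R = CFC.abs T)
    {ι : Type*} (b : HilbertBasis ι ℂ H) : traceNorm T = ∑' i, ‖R (b i)‖ₑ ^ 2 := by
  rw [hs_basis b (stdBasis H)]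
  simp only [traceNorm, ofReal_inner_sqrt h1 h2]

/-- The trace norm may be computed in any orthonormal basis. -/
theorem traceNorm_eq {ι : Type*} (b : HilbertBasis ι ℂ H) (T : H →L[ℂ] H) :
    traceNorm T = ∑' i, ENNReal.ofReal (RCLike.re ⟪b i, CFC.abs T (b i)⟫_ℂ) := by
  obtain ⟨R, h1, h2⟩ := exists_sqrt_abs T
  simp only [traceNorm_eq_hs h1 h2 b, ofReal_inner_sqrt h1 h2]

theorem enorm_inner_le_half {L : Type*} [NormedAddCommGroup L] [InnerProductSpace ℂ L]
    (x y : L) : ‖⟪x, y⟫_ℂ‖ₑ ≤ (‖x‖ₑ ^ 2 + ‖y‖ₑ ^ 2) / 2 := by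
  have h : ‖⟪x, y⟫_ℂ‖ ≤ (‖x‖ ^ 2 + ‖y‖ ^ 2) / 2 := by
    nlinarith [norm_inner_le_norm (𝕜 := ℂ) x y, sq_nonneg (‖x‖ - ‖y‖)]
  have h2 := ENNReal.ofReal_le_ofReal h
  rwa [ofReal_norm, ENNReal.ofReal_div_of_pos two_pos, ENNReal.ofReal_add (by positivity)
    (by positivity), ENNReal.ofReal_pow (norm_nonneg _), ENNReal.ofReal_pow (norm_nonneg _),
    ofReal_norm, ofReal_norm, ENNReal.ofReal_ofNat] at h2

theorem tsum_enorm_inner_le {ι : Type*} (b : HilbertBasis ι ℂ K) (V W : K →L[ℂ] H)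
    (T : H →L[ℂ] H) :
    ∑' i, ‖⟪W (b i), T (V (b i))⟫_ℂ‖ₑ ≤ (‖W‖ₑ ^ 2 + ‖V‖ₑ ^ 2) / 2 * traceNorm T := by
  obtain ⟨U, hU, hT, -⟩ := exists_polar T
  obtain ⟨R, h1, h2⟩ := exists_sqrt_abs T
  have key : ∀ x y : H, ⟪x, T y⟫_ℂ = ⟪R (U.adjoint x), R y⟫_ℂ := by
    intro x y
    conv_lhs => rw [hT, ← h2]
    simp only [ContinuousLinearMap.comp_apply]
    rw [← ContinuousLinearMap.adjoint_inner_left U, ← ContinuousLinearMap.adjoint_inner_left R, h1]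
  have hUn : ‖U.adjoint‖ₑ ≤ 1 := by
    rw [← ofReal_norm, LinearIsometryEquiv.norm_map]
    exact ENNReal.ofReal_le_one.mpr hU
  calc ∑' i, ‖⟪W (b i), T (V (b i))⟫_ℂ‖ₑ
      ≤ ∑' i, (‖R ((U.adjoint ∘L W) (b i))‖ₑ ^ 2 + ‖R (V (b i))‖ₑ ^ 2) / 2 := by
        refine ENNReal.tsum_le_tsum fun i => ?_
        rw [key]
        exact enorm_inner_le_half _ _
    _ = (∑' i, ‖R ((U.adjoint ∘L W) (b i))‖ₑ ^ 2 + ∑' i, ‖R (V (b i))‖ₑ ^ 2) / 2 := by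
        simp_rw [div_eq_mul_inv]
        rw [ENNReal.tsum_mul_right, ENNReal.tsum_add]
    _ ≤ (‖W‖ₑ ^ 2 * traceNorm T + ‖V‖ₑ ^ 2 * traceNorm T) / 2 := by
        gcongr
        · refine (hs_comp_right_le b (stdBasis H) R (U.adjoint ∘L W)).trans ?_
          rw [← traceNorm_eq_hs h1 h2]
          gcongr
          refine (ContinuousLinearMap.opENorm_comp_le _ _).trans ?_
          exact mul_le_of_le_one_left (by positivity) hUn
        · refine (hs_comp_right_le b (stdBasis H) R V).trans ?_
          rw [← traceNorm_eq_hs h1 h2]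
    _ = _ := by
        rw [← add_mul, div_eq_mul_inv, div_eq_mul_inv]; ring

theorem traceNorm_le_tsum_of_polar {T U : H →L[ℂ] H} (hU : CFC.abs T = U.adjoint ∘L T)
    {ι : Type*} (b : HilbertBasis ι ℂ H) :
    traceNorm T ≤ ∑' i, ‖⟪U (b i), T (b i)⟫_ℂ‖ₑ := by
  rw [traceNorm_eq b]
  refine ENNReal.tsum_le_tsum fun i => ?_
  rw [hU, ContinuousLinearMap.comp_apply, ContinuousLinearMap.adjoint_inner_right, ← ofReal_norm]
  exact ENNReal.ofReal_le_ofReal (RCLike.re_le_norm _)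

theorem half_le_one {V W : K →L[ℂ] H} (hV : ‖V‖ ≤ 1) (hW : ‖W‖ ≤ 1) :
    (‖W‖ₑ ^ 2 + ‖V‖ₑ ^ 2) / 2 ≤ 1 := by
  have hV' : ‖V‖ₑ ≤ 1 := by rw [← ofReal_norm]; exact ENNReal.ofReal_le_one.mpr hV
  have hW' : ‖W‖ₑ ≤ 1 := by rw [← ofReal_norm]; exact ENNReal.ofReal_le_one.mpr hW
  refine ENNReal.div_le_of_le_mul ?_
  calc ‖W‖ₑ ^ 2 + ‖V‖ₑ ^ 2 ≤ 1 ^ 2 + 1 ^ 2 := by gcongr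
    _ = 1 * 2 := by norm_num

theorem traceNorm_add_le (S T : H →L[ℂ] H) : traceNorm (S + T) ≤ traceNorm S + traceNorm T := by
  obtain ⟨U, hU, -, h⟩ := exists_polar (S + T)
  have h1 : ‖ContinuousLinearMap.id ℂ H‖ ≤ 1 := ContinuousLinearMap.norm_id_le
  have hle : ∀ Q : H →L[ℂ] H, ∑' i, ‖⟪U (stdBasis H i), Q (stdBasis H i)⟫_ℂ‖ₑ ≤ traceNorm Q :=
    fun Q => (tsum_enorm_inner_le (stdBasis H) (ContinuousLinearMap.id ℂ H) U Q).trans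
      (mul_le_of_le_one_left (by positivity) (half_le_one h1 hU))
  refine (traceNorm_le_tsum_of_polar h (stdBasis H)).trans ?_
  refine le_trans ?_ (add_le_add (hle S) (hle T))
  rw [← ENNReal.tsum_add]
  refine ENNReal.tsum_le_tsum fun i => ?_
  rw [add_apply, inner_add_right]
  exact enorm_add_le _ _

theorem traceNorm_smul (c : ℂ) (T : H →L[ℂ] H) : traceNorm (c • T) = ‖c‖ₑ * traceNorm T := by
  have h : CFC.abs (c • T) = ‖c‖ • CFC.abs T := CFC.abs_smul c T
  simp only [traceNorm, h]
  rw [← ENNReal.tsum_mul_left]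
  congr 1; funext i
  rw [smul_apply, inner_smul_right_eq_smul, RCLike.smul_re,
    ENNReal.ofReal_mul (norm_nonneg _), ofReal_norm]

theorem traceNorm_zero : traceNorm (0 : H →L[ℂ] H) = 0 := by
  simp [traceNorm]

theorem eq_zero_of_traceNorm_eq_zero {T : H →L[ℂ] H} (h : traceNorm T = 0) : T = 0 := by
  obtain ⟨R, h1, h2⟩ := exists_sqrt_abs T
  rw [traceNorm_eq_hs h1 h2 (stdBasis H), hs_adjoint _ (stdBasis H), h1] at h
  have hR : ∀ x, R x = 0 := by
    intro x
    have hx : ∀ i, ⟪stdBasis H i, R x⟫_ℂ = 0 := by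
      intro i
      have := (ENNReal.tsum_eq_zero.mp h) i
      have h0 : R (stdBasis H i) = 0 := by simpa using this
      rw [← h1, ContinuousLinearMap.adjoint_inner_right, h0, inner_zero_left]
    have h3 := enorm_sq_eq (stdBasis H) (R x)
    simpa [hx] using h3
  have hA : CFC.abs T = 0 := by
    rw [← h2]; ext x; simp [hR]
  exact CFC.abs_eq_zero_iff.mp hA

theorem traceNorm_sandwich_ne_top (A : H →L[ℂ] K) (B : K →L[ℂ] H) {T : H →L[ℂ] H}
    (hT : traceNorm T ≠ ∞) : traceNorm (A ∘L T ∘L B) ≠ ∞ := by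
  obtain ⟨U, -, -, h⟩ := exists_polar (A ∘L T ∘L B)
  refine ne_top_of_le_ne_top ?_ (traceNorm_le_tsum_of_polar h (stdBasis K))
  have := tsum_enorm_inner_le (stdBasis K) B (A.adjoint ∘L U) T
  simp only [ContinuousLinearMap.comp_apply, ContinuousLinearMap.adjoint_inner_left] at this
  refine ne_top_of_le_ne_top ?_ this
  refine ENNReal.mul_ne_top (ENNReal.div_ne_top ?_ two_ne_zero) hT
  finiteness

theorem traceNorm_rankOne_ne_top (x y : H) :
    traceNorm (InnerProductSpace.rankOne ℂ x y) ≠ ∞ := by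
  obtain ⟨U, -, -, h⟩ := exists_polar (InnerProductSpace.rankOne ℂ x y)
  refine ne_top_of_le_ne_top ?_ (traceNorm_le_tsum_of_polar h (stdBasis H))
  refine ne_top_of_le_ne_top (b := (‖y‖ₑ ^ 2 + ‖U.adjoint x‖ₑ ^ 2) / 2) ?_ ?_
  · refine ENNReal.div_ne_top ?_ two_ne_zero
    finiteness
  · rw [enorm_sq_eq (stdBasis H) y, enorm_sq_eq (stdBasis H) (U.adjoint x), ← ENNReal.tsum_add,
      div_eq_mul_inv, ← ENNReal.tsum_mul_right]
    refine ENNReal.tsum_le_tsum fun i => ?_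
    have h2 := enorm_inner_le_half ⟪stdBasis H i, y⟫_ℂ ⟪stdBasis H i, U.adjoint x⟫_ℂ
    rw [div_eq_mul_inv] at h2
    refine le_trans (le_of_eq ?_) h2
    rw [InnerProductSpace.rankOne_apply, inner_smul_right, ← ContinuousLinearMap.adjoint_inner_right,
      RCLike.inner_apply, inner_conj_symm, mul_comm]

theorem hasSum_inner_adjoint {ι κ : Type*} (b : HilbertBasis ι ℂ H) (c : HilbertBasis κ ℂ K)
    (A B : H →L[ℂ] K) (hA : ∑' i, ‖A (b i)‖ₑ ^ 2 ≠ ∞) (hB : ∑' i, ‖B (b i)‖ₑ ^ 2 ≠ ∞) :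
    ∃ t, HasSum (fun i => ⟪A (b i), B (b i)⟫_ℂ) t ∧
      HasSum (fun j => ⟪B.adjoint (c j), A.adjoint (c j)⟫_ℂ) t := by
  obtain ⟨f, hfd⟩ : ∃ f : ι × κ → ℂ, ∀ i j, f (i, j) = ⟪A (b i), c j⟫_ℂ * ⟪c j, B (b i)⟫_ℂ :=
    ⟨fun p => ⟪A (b p.1), c p.2⟫_ℂ * ⟪c p.2, B (b p.1)⟫_ℂ, fun _ _ => rfl⟩
  have hf : Summable f := by
    have : ∑' p, ‖f p‖ₑ ≠ ∞ := by
      rw [ENNReal.tsum_prod']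
      refine ne_top_of_le_ne_top
        (b := (∑' i, ‖A (b i)‖ₑ ^ 2 + ∑' i, ‖B (b i)‖ₑ ^ 2) / 2) ?_ ?_
      · exact ENNReal.div_ne_top (ENNReal.add_ne_top.mpr ⟨hA, hB⟩) two_ne_zero
      · rw [← ENNReal.tsum_add, div_eq_mul_inv, ← ENNReal.tsum_mul_right]
        refine ENNReal.tsum_le_tsum fun i => ?_
        rw [enorm_sq_eq c, enorm_sq_eq c, ← ENNReal.tsum_add, ← ENNReal.tsum_mul_right]
        refine ENNReal.tsum_le_tsum fun j => ?_
        have h2 := enorm_inner_le_half ⟪c j, A (b i)⟫_ℂ ⟪c j, B (b i)⟫_ℂ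
        rw [div_eq_mul_inv] at h2
        refine le_trans (le_of_eq ?_) h2
        rw [hfd, RCLike.inner_apply, inner_conj_symm, mul_comm]
    refine Summable.of_norm ?_
    have h3 := ENNReal.summable_toReal this
    simpa using h3
  have hsum := hf.hasSum
  refine ⟨∑' p, f p, ?_, ?_⟩
  · refine hsum.prod_fiberwise (g := fun i => ⟪A (b i), B (b i)⟫_ℂ) fun i => ?_
    simp only [hfd]
    exact c.hasSum_inner_mul_inner _ _
  · have h4 : HasSum (f ∘ (Equiv.prodComm κ ι)) (∑' p, f p) :=
      (Equiv.hasSum_iff (f := f) (Equiv.prodComm κ ι)).mpr hsum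
    refine h4.prod_fiberwise (g := fun j => ⟪B.adjoint (c j), A.adjoint (c j)⟫_ℂ) fun j => ?_
    have h5 := b.hasSum_inner_mul_inner (B.adjoint (c j)) (A.adjoint (c j))
    have h6 : (fun i => ⟪B.adjoint (c j), b i⟫_ℂ * ⟪b i, A.adjoint (c j)⟫_ℂ) =
        fun i => (f ∘ (Equiv.prodComm κ ι)) (j, i) := by
      funext i
      rw [ContinuousLinearMap.adjoint_inner_left, ContinuousLinearMap.adjoint_inner_right, mul_comm,
        ← hfd i j]
      rfl
    rwa [h6] at h5

theorem hasSum_inner {ι : Type*} (b : HilbertBasis ι ℂ H) (T : H →L[ℂ] H)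
    (hT : traceNorm T ≠ ∞) :
    HasSum (fun i => ⟪b i, T (b i)⟫_ℂ) (∑' j, ⟪stdBasis H j, T (stdBasis H j)⟫_ℂ) := by
  obtain ⟨U, hU, hUT, -⟩ := exists_polar T
  obtain ⟨R, h1, h2⟩ := exists_sqrt_abs T
  have hR' : ∑' i, ‖R (stdBasis H i)‖ₑ ^ 2 ≠ ∞ := by
    rwa [← traceNorm_eq_hs h1 h2]
  have hRU : ∑' i, ‖(R ∘L U.adjoint) (stdBasis H i)‖ₑ ^ 2 ≠ ∞ := by
    refine ne_top_of_le_ne_top ?_ (hs_comp_right_le (stdBasis H) (stdBasis H) R U.adjoint)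
    exact ENNReal.mul_ne_top (by finiteness) hR'
  have key : ∀ x : H, ⟪x, T x⟫_ℂ = ⟪(R ∘L U.adjoint) x, R x⟫_ℂ := by
    intro x
    conv_lhs => rw [hUT, ← h2]
    simp only [ContinuousLinearMap.comp_apply]
    rw [← ContinuousLinearMap.adjoint_inner_left U, ← ContinuousLinearMap.adjoint_inner_left R, h1]
  obtain ⟨t, ht, ht'⟩ := hasSum_inner_adjoint (stdBasis H) (stdBasis H) _ _ hRU hR'
  obtain ⟨s, hs, hs'⟩ := hasSum_inner_adjoint b (stdBasis H) (R ∘L U.adjoint) R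
    (by rwa [hs_basis b (stdBasis H)]) (by rwa [hs_basis b (stdBasis H)])
  simp_rw [key]
  rw [ht.tsum_eq, ht'.unique hs']
  exact hs

end TraceNorm

/-! ### The space `L¹(H)` of trace-class operators -/

section TraceClass

variable (H : Type u) [NormedAddCommGroup H] [InnerProductSpace ℂ H] [CompleteSpace H]

/-- The trace-class operators, as a linear subspace of the bounded operators. -/
noncomputable def traceClass : Submodule ℂ (H →L[ℂ] H) where
  carrier := {T | traceNorm T ≠ ∞}
  add_mem' {S T} hS hT :=
    ne_top_of_le_ne_top (ENNReal.add_ne_top.mpr ⟨hS, hT⟩) (traceNorm_add_le S T)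
  zero_mem' := by simp [traceNorm_zero]
  smul_mem' c T hT := by
    simp only [Set.mem_ofPred_eq, traceNorm_smul] at hT ⊢
    exact ENNReal.mul_ne_top enorm_ne_top hT

/-- `L¹(H)`: a copy of the space of trace-class operators, to carry the trace norm. -/
def L1 : Type u := traceClass H

noncomputable instance : AddCommGroup (L1 H) := inferInstanceAs (AddCommGroup (traceClass H))

noncomputable instance : Module ℂ (L1 H) := inferInstanceAs (Module ℂ (traceClass H))

variable {H} in
/-- The inclusion `L¹(H) ⊆ B(H)`. -/
noncomputable def L1.toOp : L1 H →ₗ[ℂ] (H →L[ℂ] H) := (traceClass H).subtype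

noncomputable instance : Norm (L1 H) := ⟨fun T => (traceNorm T.toOp).toReal⟩

theorem L1.core : NormedSpace.Core ℂ (L1 H) where
  norm_nonneg _ := ENNReal.toReal_nonneg
  norm_smul c T := by
    change (traceNorm (L1.toOp (c • T))).toReal = _ * (traceNorm (L1.toOp T)).toReal
    rw [map_smul, traceNorm_smul, ENNReal.toReal_mul, toReal_enorm]
  norm_triangle S T := by
    change (traceNorm (L1.toOp (S + T))).toReal ≤
      (traceNorm (L1.toOp S)).toReal + (traceNorm (L1.toOp T)).toReal
    have hS : traceNorm (L1.toOp S) ≠ ∞ := S.2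
    have hT : traceNorm (L1.toOp T) ≠ ∞ := T.2
    rw [map_add, ← ENNReal.toReal_add hS hT]
    exact ENNReal.toReal_mono (ENNReal.add_ne_top.mpr ⟨hS, hT⟩) (traceNorm_add_le _ _)
  norm_eq_zero_iff T := by
    change (traceNorm (L1.toOp T)).toReal = 0 ↔ _
    constructor
    · intro h
      rcases (ENNReal.toReal_eq_zero_iff _).mp h with h | h
      · exact Subtype.ext (eq_zero_of_traceNorm_eq_zero h)
      · exact absurd h T.2
    · rintro rfl
      rw [map_zero, traceNorm_zero, ENNReal.toReal_zero]

/-- The trace norm on `L¹(H)`. -/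
noncomputable instance : NormedAddCommGroup (L1 H) := NormedAddCommGroup.ofCore (L1.core H)

noncomputable instance : NormedSpace ℂ (L1 H) := NormedSpace.ofCore (L1.core H)

variable {H}

theorem L1.norm_def (T : L1 H) : ‖T‖ = (traceNorm T.toOp).toReal := rfl

@[ext] theorem L1.ext {S T : L1 H} (h : S.toOp = T.toOp) : S = T := Subtype.ext h

/-- The trace `tr(T) = ∑ᵢ ⟨eᵢ, T eᵢ⟩`; the series converges absolutely and does not depend on
the orthonormal basis, see `L1.hasSum_trace`. -/
noncomputable def L1.trace (T : L1 H) : ℂ := ∑' i, ⟪stdBasis H i, T.toOp (stdBasis H i)⟫_ℂ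

theorem L1.hasSum_trace {ι : Type*} (b : HilbertBasis ι ℂ H) (T : L1 H) :
    HasSum (fun i => ⟪b i, T.toOp (b i)⟫_ℂ) T.trace := hasSum_inner b T.toOp T.2

/-- The operator `|x⟩⟨y|` as an element of `L¹(H)`. -/
noncomputable def L1.ketbra (x y : H) : L1 H :=
  ⟨InnerProductSpace.rankOne ℂ x y, traceNorm_rankOne_ne_top x y⟩

@[simp] theorem L1.toOp_ketbra (x y : H) :
    (L1.ketbra x y).toOp = InnerProductSpace.rankOne ℂ x y := rfl

variable {K : Type v} [NormedAddCommGroup K] [InnerProductSpace ℂ K] [CompleteSpace K]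

/-- The linear map `L¹(H) → L¹(K)`, `T ↦ A T B`, for bounded `A : H → K` and `B : K → H`. -/
noncomputable def L1.sandwich (A : H →L[ℂ] K) (B : K →L[ℂ] H) : L1 H →ₗ[ℂ] L1 K where
  toFun T := ⟨A ∘L T.toOp ∘L B, traceNorm_sandwich_ne_top A B T.2⟩
  map_add' S T := by
    refine Subtype.ext ?_
    change A ∘L L1.toOp (S + T) ∘L B = A ∘L L1.toOp S ∘L B + A ∘L L1.toOp T ∘L B
    ext x; simp
  map_smul' c T := by
    refine Subtype.ext ?_
    change A ∘L L1.toOp (c • T) ∘L B = c • (A ∘L L1.toOp T ∘L B)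
    ext x; simp

@[simp] theorem L1.toOp_sandwich (A : H →L[ℂ] K) (B : K →L[ℂ] H) (T : L1 H) :
    (L1.sandwich A B T).toOp = A ∘L T.toOp ∘L B := rfl

end TraceClass

/-! ### Hilbert space tensor products -/

section Tensor

variable (H : Type u) [NormedAddCommGroup H] [InnerProductSpace ℂ H]
variable (K : Type v) [NormedAddCommGroup K] [InnerProductSpace ℂ K]

/-- The Hilbert space tensor product: the completion of the algebraic tensor product with
respect to the inner product `⟨x ⊗ y, x' ⊗ y'⟩ = ⟨x, x'⟩ ⟨y, y'⟩`. -/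
abbrev HTensor : Type (max u v) := UniformSpace.Completion (H ⊗[ℂ] K)

variable {H K}

/-- The elementary tensor `x ⊗ y` in the Hilbert space tensor product. -/
noncomputable def htmul (x : H) (y : K) : HTensor H K := ((x ⊗ₜ[ℂ] y : H ⊗[ℂ] K) : HTensor H K)

/-- The bounded operator `A ⊗ B` on `H ⊗ K`, with `(A ⊗ B)(x ⊗ y) = A x ⊗ B y`. -/
noncomputable def opTensor (A : H →L[ℂ] H) (B : K →L[ℂ] K) : HTensor H K →L[ℂ] HTensor H K :=
  (TensorProduct.mapL A B).completion

theorem opTensor_htmul (A : H →L[ℂ] H) (B : K →L[ℂ] K) (x : H) (y : K) :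
    opTensor A B (htmul x y) = htmul (A x) (B y) := by
  simp [opTensor, htmul]

theorem htmul_smul_left (c : ℂ) (x : H) (y : K) : htmul (c • x) y = c • htmul x y := by
  rw [htmul, htmul, ← UniformSpace.Completion.coe_smul, TensorProduct.smul_tmul']

variable (K) in
/-- The operator `|x⟩ ⊗ 1 : K → H ⊗ K`, `y ↦ x ⊗ y`. -/
noncomputable def ketTensor (x : H) : K →L[ℂ] HTensor H K :=
  UniformSpace.Completion.toComplL ∘L TensorProduct.mkL ℂ H K x

@[simp] theorem ketTensor_apply (x : H) (y : K) : ketTensor K x y = htmul x y := rfl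

theorem inner_htmul (x x' : H) (y y' : K) :
    ⟪htmul x y, htmul x' y'⟫_ℂ = ⟪x, x'⟫_ℂ * ⟪y, y'⟫_ℂ := by
  simp [htmul]

theorem htensor_ext {L : Type*} [NormedAddCommGroup L] [NormedSpace ℂ L]
    {A B : HTensor H K →L[ℂ] L} (h : ∀ x y, A (htmul x y) = B (htmul x y)) : A = B := by
  ext z
  induction z using UniformSpace.Completion.induction_on with
  | hp => exact isClosed_eq (by fun_prop) (by fun_prop)
  | ih z =>
    induction z using TensorProduct.induction_on with
    | zero => rw [UniformSpace.Completion.coe_zero, map_zero, map_zero]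
    | tmul x y => exact h x y
    | add a b ha hb => rw [UniformSpace.Completion.coe_add, map_add, map_add, ha, hb]

variable [CompleteSpace H] [CompleteSpace K]

theorem ketTensor_adjoint_htmul (x x' : H) (y : K) :
    (ketTensor K x).adjoint (htmul x' y) = ⟪x, x'⟫_ℂ • y := by
  refine ext_inner_left ℂ fun z => ?_
  rw [ContinuousLinearMap.adjoint_inner_right, ketTensor_apply, inner_htmul, inner_smul_right]

theorem opTensor_rankOne (x y : H) (T : K →L[ℂ] K) :
    opTensor (InnerProductSpace.rankOne ℂ x y) T =
      ketTensor K x ∘L T ∘L (ketTensor K y).adjoint := by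
  refine htensor_ext fun a b => ?_
  rw [opTensor_htmul]
  simp only [ContinuousLinearMap.comp_apply, ketTensor_adjoint_htmul, map_smul, ketTensor_apply,
    InnerProductSpace.rankOne_apply]
  rw [htmul_smul_left]

/-- The linear map `L¹(K) → L¹(H ⊗ K)`, `T ↦ |x⟩⟨y| ⊗ T`. -/
noncomputable def rankOneTensor (x y : H) : L1 K →ₗ[ℂ] L1 (HTensor H K) where
  toFun T := ⟨opTensor (InnerProductSpace.rankOne ℂ x y) T.toOp, by
    rw [opTensor_rankOne]
    exact traceNorm_sandwich_ne_top _ _ T.2⟩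
  map_add' S T := L1.ext (by
    change opTensor (InnerProductSpace.rankOne ℂ x y) (L1.toOp (S + T)) =
      opTensor (InnerProductSpace.rankOne ℂ x y) (L1.toOp S) +
        opTensor (InnerProductSpace.rankOne ℂ x y) (L1.toOp T)
    rw [map_add]
    refine htensor_ext fun a b => ?_
    simp [opTensor_rankOne, -ketTensor_apply])
  map_smul' c T := L1.ext (by
    change opTensor (InnerProductSpace.rankOne ℂ x y) (L1.toOp (c • T)) =
      c • opTensor (InnerProductSpace.rankOne ℂ x y) (L1.toOp T)
    rw [map_smul]
    refine htensor_ext fun a b => ?_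
    simp [opTensor_rankOne, -ketTensor_apply])

@[simp] theorem toOp_rankOneTensor (x y : H) (T : L1 K) :
    (rankOneTensor x y T).toOp = opTensor (InnerProductSpace.rankOne ℂ x y) T.toOp := rfl

end Tensor

/-! ### Complete positivity and Choi matrices -/

section Channel

variable {H : Type u} [NormedAddCommGroup H] [InnerProductSpace ℂ H] [CompleteSpace H]
variable {K : Type v} [NormedAddCommGroup K] [InnerProductSpace ℂ K] [CompleteSpace K]

/-- The standard basis vector `e_k` of `ℂⁿ`. -/
noncomputable def stdVec (n : ℕ) (k : Fin n) : EuclideanSpace ℂ (Fin n) :=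
  EuclideanSpace.single k 1

/-- The entry `S_{kl} = (⟨e_k| ⊗ 1) S (|e_l⟩ ⊗ 1) ∈ L¹(H)` of `S ∈ L¹(ℂⁿ ⊗ H)`. -/
noncomputable def entry (n : ℕ) (k l : Fin n) :
    L1 (HTensor (EuclideanSpace ℂ (Fin n)) H) →ₗ[ℂ] L1 H :=
  L1.sandwich (ketTensor H (stdVec n k)).adjoint (ketTensor H (stdVec n l))

/-- The map `id_n ⊗ Φ : L¹(ℂⁿ ⊗ H) → L¹(ℂⁿ ⊗ K)`, which applies `Φ` to each entry:
`S = ∑ E_{kl} ⊗ S_{kl} ↦ ∑ E_{kl} ⊗ Φ(S_{kl})`. By `sum_rankOneTensor_entry` and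
`idTensor_rankOneTensor` it is the unique linear map with
`|x⟩⟨y| ⊗ s ↦ |x⟩⟨y| ⊗ Φ(s)` for all `x, y ∈ ℂⁿ` and `s ∈ L¹(H)`. -/
noncomputable def idTensor (n : ℕ) (Φ : L1 H →ₗ[ℂ] L1 K) :
    L1 (HTensor (EuclideanSpace ℂ (Fin n)) H) →ₗ[ℂ]
      L1 (HTensor (EuclideanSpace ℂ (Fin n)) K) :=
  ∑ k, ∑ l, rankOneTensor (stdVec n k) (stdVec n l) ∘ₗ Φ ∘ₗ entry n k l

theorem inner_stdVec (n : ℕ) (k : Fin n) (x : EuclideanSpace ℂ (Fin n)) :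
    ⟪stdVec n k, x⟫_ℂ = x k := by
  simp [stdVec, EuclideanSpace.inner_single_left]

theorem inner_stdVec_right (n : ℕ) (k : Fin n) (x : EuclideanSpace ℂ (Fin n)) :
    ⟪x, stdVec n k⟫_ℂ = star (x k) := by
  rw [← inner_conj_symm, inner_stdVec]
  rfl

theorem sum_stdVec (n : ℕ) (x : EuclideanSpace ℂ (Fin n)) : ∑ k, x k • stdVec n k = x := by
  ext i
  simp [stdVec, Pi.single_apply]

theorem entry_rankOneTensor (n : ℕ) (k l : Fin n) (x y : EuclideanSpace ℂ (Fin n)) (s : L1 H) :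
    entry n k l (rankOneTensor x y s) = (x k * star (y l)) • s := by
  refine L1.ext ?_
  ext h
  simp only [entry, L1.toOp_sandwich, toOp_rankOneTensor, opTensor_rankOne,
    ContinuousLinearMap.comp_apply, ketTensor_apply, ketTensor_adjoint_htmul, inner_stdVec,
    inner_stdVec_right, map_smul, smul_apply, smul_smul]
  rw [mul_comm]

theorem sum_ketTensor (n : ℕ) (z : HTensor (EuclideanSpace ℂ (Fin n)) H) :
    ∑ k, ketTensor H (stdVec n k) ((ketTensor H (stdVec n k)).adjoint z) = z := by
  have h : ∑ k, ketTensor H (stdVec n k) ∘L (ketTensor H (stdVec n k)).adjoint =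
      ContinuousLinearMap.id ℂ (HTensor (EuclideanSpace ℂ (Fin n)) H) := by
    refine htensor_ext fun x y => ?_
    simp only [sum_apply, ContinuousLinearMap.comp_apply,
      ketTensor_adjoint_htmul, inner_stdVec, map_smul, ketTensor_apply,
      ContinuousLinearMap.id_apply]
    simp_rw [← htmul_smul_left]
    conv_rhs => rw [← sum_stdVec n x]
    simp only [htmul, TensorProduct.sum_tmul]
    exact (map_sum (UniformSpace.Completion.toComplL (𝕜 := ℂ)
      (E := EuclideanSpace ℂ (Fin n) ⊗[ℂ] H)) _ _).symm
  have := congrArg (fun A => A z) h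
  simpa using this

theorem sum_rankOneTensor_entry (n : ℕ) (S : L1 (HTensor (EuclideanSpace ℂ (Fin n)) H)) :
    ∑ k, ∑ l, rankOneTensor (stdVec n k) (stdVec n l) (entry n k l S) = S := by
  refine L1.ext ?_
  ext1 z
  simp only [map_sum, toOp_rankOneTensor, opTensor_rankOne, entry, L1.toOp_sandwich,
    sum_apply, ContinuousLinearMap.comp_apply]
  simp_rw [← map_sum, sum_ketTensor]

theorem idTensor_rankOneTensor (n : ℕ) (Φ : L1 H →ₗ[ℂ] L1 K) (x y : EuclideanSpace ℂ (Fin n))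
    (s : L1 H) : idTensor n Φ (rankOneTensor x y s) = rankOneTensor x y (Φ s) := by
  conv_rhs => rw [← sum_rankOneTensor_entry n (rankOneTensor x y (Φ s))]
  simp only [idTensor, LinearMap.sum_apply, LinearMap.comp_apply, entry_rankOneTensor, map_smul]

/-- `Φ` is completely positive: `id_n ⊗ Φ` maps positive operators to positive operators,
for every `n`. -/
def IsCP (Φ : L1 H →ₗ[ℂ] L1 K) : Prop :=
  ∀ (n : ℕ) (S : L1 (HTensor (EuclideanSpace ℂ (Fin n)) H)),
    S.toOp.IsPositive → (idTensor n Φ S).toOp.IsPositive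

/-- `Φ` is completely positive and trace-preserving. -/
def IsCPTP (Φ : L1 H →ₗ[ℂ] L1 K) : Prop :=
  IsCP Φ ∧ ∀ s : L1 H, (Φ s).trace = s.trace

variable {ι : Type w}

/-- The elementary matrix `E_{ij} = |e_i⟩⟨e_j| ∈ L¹(H)` for an orthonormal basis `e`. -/
noncomputable def elemMatrix (e : HilbertBasis ι ℂ H) (i j : ι) : L1 H := L1.ketbra (e i) (e j)

/-- The Choi matrix `∑_{i,j ∈ F} E_{ij} ⊗ Φ(E_{ij}) ∈ L¹(H ⊗ K)`. -/
noncomputable def choiMatrix (e : HilbertBasis ι ℂ H) (Φ : L1 H →ₗ[ℂ] L1 K) (F : Finset ι) :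
    L1 (HTensor H K) :=
  ∑ i ∈ F, ∑ j ∈ F, rankOneTensor (e i) (e j) (Φ (elemMatrix e i j))

end Channel

end ChoiJam

/-!
A bounded map `Φ : L¹(H) → L¹(K)` is completely positive if and only if all its finite Choi matrices
`C^(F)` are positive, since both conditions express the positivity of operator matrices with
entries in `L¹(K)`: `∑ |v_i⟩⟨v_j| ⊗ T i j`, for an orthonormal family `v`, is positive if and only if
`∑ ⟨y_i, T i j y_j⟩ ≥ 0` for all finite families `y` (`isPositive_sum_rankOneTensor_iff`). For
`C^(F)` the entries are `Φ(E_{ij})`; for `(id_n ⊗ Φ)(S)` they are `Φ(S_{kl})`.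

If `Φ` is completely positive, apply it to `S = |ψ⟩⟨ψ|` with `ψ = ∑ e_k ⊗ x_k`: for basis vectors
`x_k` this gives the quadratic form of the Choi matrix (`IsCP.isPositive_choiMatrix`).

Conversely, let `S ≥ 0` on `ℂⁿ ⊗ H`, and write `⟨v, S w⟩ = ⟨R v, R w⟩` with `R = √S`. Replace every entry
`S_{kl}` by its truncation `∑_{i,j ∈ F} ⟨e_i, S_{kl} e_j⟩ E_{ij}`. Expanding
`⟨e_i, S_{kl} e_j⟩ = ⟨R (e_k ⊗ e_i), R (e_l ⊗ e_j)⟩` in an orthonormal basis of `ℂⁿ ⊗ H` exhibits the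
quadratic form of the image under `Φ` as a convergent sum of values of the quadratic form of
`C^(F)`, hence as nonnegative (`sum_truncate_nonneg`). The truncations converge to `S_{kl}` in the
trace norm as `F` grows (`tendsto_truncate`), and `Φ` is bounded for the trace norm, so the
inequality passes to the limit (`isCP_of_isPositive_choiMatrix`).

The trace is bounded on `L¹`, so by the same convergence `tr Φ(s) = tr s` need only be checked on
the `E_{ij}`, where `tr E_{ij} = δ_{ij}` (`trace_map_eq_of_elemMatrix`).
-/

namespace ChoiJam

open scoped ComplexOrder
open Filter Topology

universe u v w

variable {H : Type u} [NormedAddCommGroup H] [InnerProductSpace ℂ H] [CompleteSpace H]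
variable {K : Type v} [NormedAddCommGroup K] [InnerProductSpace ℂ K] [CompleteSpace K]

/-! ### Continuity of the trace and of matrix elements in the trace norm -/

theorem L1.enorm_eq (T : L1 H) : ‖T‖ₑ = traceNorm T.toOp := by
  rw [← ofReal_norm, L1.norm_def]
  exact ENNReal.ofReal_toReal T.2

theorem tsum_enorm_inner_self_le {ι : Type*} (b : HilbertBasis ι ℂ H) (T : H →L[ℂ] H) :
    ∑' i, ‖⟪b i, T (b i)⟫_ℂ‖ₑ ≤ traceNorm T := by
  have h : ‖ContinuousLinearMap.id ℂ H‖ ≤ 1 := ContinuousLinearMap.norm_id_le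
  exact (tsum_enorm_inner_le b (ContinuousLinearMap.id ℂ H) (ContinuousLinearMap.id ℂ H) T).trans
    (mul_le_of_le_one_left (by positivity) (half_le_one h h))

theorem L1.enorm_trace_le (T : L1 H) : ‖T.trace‖ₑ ≤ ‖T‖ₑ := by
  rw [L1.enorm_eq]
  exact enorm_tsum_le_tsum_enorm.trans (tsum_enorm_inner_self_le (stdBasis H) T.toOp)

variable (H) in
/-- The trace as a bounded linear functional on `L¹(H)`. -/
noncomputable def traceCLM : L1 H →L[ℂ] ℂ :=
  LinearMap.mkContinuous
    { toFun := L1.trace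
      map_add' := fun S T => by
        refine (L1.hasSum_trace (stdBasis H) (S + T)).unique ?_
        simpa [inner_add_right] using
          (L1.hasSum_trace (stdBasis H) S).add (L1.hasSum_trace (stdBasis H) T)
      map_smul' := fun c T => by
        refine (L1.hasSum_trace (stdBasis H) (c • T)).unique ?_
        simpa [inner_smul_right] using (L1.hasSum_trace (stdBasis H) T).mul_left c }
    1 fun T => by
      rw [one_mul, ← toReal_enorm, ← toReal_enorm]
      exact ENNReal.toReal_mono enorm_ne_top (L1.enorm_trace_le T)

@[simp] theorem traceCLM_apply (T : L1 H) : traceCLM H T = T.trace := rfl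

theorem enorm_inner_apply_le (x y : H) (T : H →L[ℂ] H) :
    ‖⟪x, T y⟫_ℂ‖ₑ ≤ (‖x‖ₑ ^ 2 + ‖y‖ₑ ^ 2) / 2 * traceNorm T := by
  -- In the one-dimensional space `ℂ`, the operators `1 ↦ x` and `1 ↦ y` reduce the
  -- sum over a basis to this single matrix element.
  have h := tsum_enorm_inner_le (OrthonormalBasis.singleton Unit ℂ).toHilbertBasis
    (ContinuousLinearMap.toSpanSingleton ℂ y) (ContinuousLinearMap.toSpanSingleton ℂ x) T
  have e : ∀ z : H, ‖ContinuousLinearMap.toSpanSingleton ℂ z‖ₑ = ‖z‖ₑ := fun z => by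
    rw [← ofReal_norm, ContinuousLinearMap.norm_toSpanSingleton, ofReal_norm]
  simpa [e] using h

/-- The matrix element `T ↦ ⟨x, T y⟩` as a bounded linear functional on `L¹(H)`. -/
noncomputable def matrixElementCLM (x y : H) : L1 H →L[ℂ] ℂ :=
  LinearMap.mkContinuous
    { toFun := fun T => ⟪x, T.toOp y⟫_ℂ
      map_add' := fun S T => by simp
      map_smul' := fun c T => by simp }
    ((‖x‖ ^ 2 + ‖y‖ ^ 2) / 2) fun T => by
      have h := enorm_inner_apply_le x y T.toOp
      rw [← L1.enorm_eq] at h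
      have h2 := ENNReal.toReal_mono (by finiteness) h
      simpa [ENNReal.toReal_add] using h2

@[simp] theorem matrixElementCLM_apply (x y : H) (T : L1 H) :
    matrixElementCLM x y T = ⟪x, T.toOp y⟫_ℂ := rfl

/-! ### Finite truncations converge in the trace norm -/

theorem tsum_mul_le_sqrt_mul_sqrt {ι : Type*} (f g : ι → ℝ≥0∞) :
    ∑' i, f i * g i ≤ (∑' i, f i ^ 2) ^ (1 / 2 : ℝ) * (∑' i, g i ^ 2) ^ (1 / 2 : ℝ) := by
  let _ : MeasurableSpace ι := ⊤
  have h := ENNReal.lintegral_mul_le_Lp_mul_Lq (MeasureTheory.Measure.count (α := ι))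
    Real.HolderConjugate.two_two (f := f) (g := g) (by fun_prop) (by fun_prop)
  simpa [MeasureTheory.lintegral_count] using h

/-- The Cauchy–Schwarz inequality for Hilbert–Schmidt operators: `‖A* B‖₁ ≤ ‖A‖₂ ‖B‖₂`. -/
theorem traceNorm_adjoint_comp_le {ι : Type*} (b : HilbertBasis ι ℂ H) (A B : H →L[ℂ] K) :
    traceNorm (A.adjoint ∘L B) ≤
      (∑' i, ‖A (b i)‖ₑ ^ 2) ^ (1 / 2 : ℝ) * (∑' i, ‖B (b i)‖ₑ ^ 2) ^ (1 / 2 : ℝ) := by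
  obtain ⟨U, hU, -, h⟩ := exists_polar (A.adjoint ∘L B)
  have hUn : ‖U‖ₑ ^ 2 ≤ 1 := by
    refine pow_le_one₀ (by positivity) ?_
    rw [← ofReal_norm]
    exact ENNReal.ofReal_le_one.mpr hU
  calc traceNorm (A.adjoint ∘L B) ≤ ∑' i, ‖A (U (b i))‖ₑ * ‖B (b i)‖ₑ := by
        refine (traceNorm_le_tsum_of_polar h b).trans (ENNReal.tsum_le_tsum fun i => ?_)
        rw [ContinuousLinearMap.comp_apply, ContinuousLinearMap.adjoint_inner_right]
        simp only [← ofReal_norm, ← ENNReal.ofReal_mul (norm_nonneg _)]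
        exact ENNReal.ofReal_le_ofReal (norm_inner_le_norm _ _)
    _ ≤ (∑' i, ‖A (U (b i))‖ₑ ^ 2) ^ (1 / 2 : ℝ) * (∑' i, ‖B (b i)‖ₑ ^ 2) ^ (1 / 2 : ℝ) :=
        tsum_mul_le_sqrt_mul_sqrt _ _
    _ ≤ _ := by
        gcongr ?_ ^ _ * _
        exact (hs_comp_right_le b b A U).trans (mul_le_of_le_one_left (by positivity) hUn)

/-- Every trace-class operator is a product `A* B` of two Hilbert–Schmidt operators. -/
theorem exists_eq_adjoint_comp_hs {ι : Type*} (b : HilbertBasis ι ℂ H) (T : L1 H) :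
    ∃ A B : H →L[ℂ] H, T.toOp = A.adjoint ∘L B ∧
      ∑' i, ‖A (b i)‖ₑ ^ 2 ≠ ∞ ∧ ∑' i, ‖B (b i)‖ₑ ^ 2 ≠ ∞ := by
  obtain ⟨U, -, hT, -⟩ := exists_polar T.toOp
  obtain ⟨R, h1, h2⟩ := exists_sqrt_abs T.toOp
  have hR : ∑' i, ‖R (b i)‖ₑ ^ 2 ≠ ∞ := by
    rw [← traceNorm_eq_hs h1 h2]
    exact T.2
  refine ⟨R ∘L U.adjoint, R, ?_, ?_, hR⟩
  · conv_lhs => rw [hT, ← h2]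
    rw [ContinuousLinearMap.adjoint_comp, ContinuousLinearMap.adjoint_adjoint, h1]
    rfl
  · exact ne_top_of_le_ne_top (ENNReal.mul_ne_top (by finiteness) hR)
      (hs_comp_right_le b b R U.adjoint)

variable {ι : Type w}

/-- The orthogonal projection `∑_{i ∈ F} |e_i⟩⟨e_i|`. -/
noncomputable def basisProj (e : HilbertBasis ι ℂ H) (F : Finset ι) : H →L[ℂ] H :=
  ∑ i ∈ F, InnerProductSpace.rankOne ℂ (e i) (e i)

theorem basisProj_apply (e : HilbertBasis ι ℂ H) (F : Finset ι) (x : H) :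
    basisProj e F x = ∑ i ∈ F, ⟪e i, x⟫_ℂ • e i := by
  simp [basisProj]

theorem basisProj_basis [DecidableEq ι] (e : HilbertBasis ι ℂ H) (F : Finset ι) (i : ι) :
    basisProj e F (e i) = if i ∈ F then e i else 0 := by
  simp [basisProj_apply, orthonormal_iff_ite.mp e.orthonormal]

theorem basisProj_adjoint (e : HilbertBasis ι ℂ H) (F : Finset ι) :
    (basisProj e F).adjoint = basisProj e F := by
  simp [basisProj]

theorem tsum_comp_basisProj_le (e : HilbertBasis ι ℂ H) (F : Finset ι) (A : H →L[ℂ] K) :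
    ∑' i, ‖(A ∘L basisProj e F) (e i)‖ₑ ^ 2 ≤ ∑' i, ‖A (e i)‖ₑ ^ 2 := by
  classical
  refine ENNReal.tsum_le_tsum fun i => ?_
  rw [ContinuousLinearMap.comp_apply, basisProj_basis]
  split_ifs <;> simp

theorem tendsto_tsum_sub_comp_basisProj (e : HilbertBasis ι ℂ H) (A : H →L[ℂ] K)
    (hA : ∑' i, ‖A (e i)‖ₑ ^ 2 ≠ ∞) :
    Tendsto (fun F => (∑' i, ‖(A - A ∘L basisProj e F) (e i)‖ₑ ^ 2) ^ (1 / 2 : ℝ))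
      atTop (𝓝 0) := by
  classical
  have h := (ENNReal.tendsto_tsum_compl_atTop_zero hA).ennrpow_const (1 / 2 : ℝ)
  rw [ENNReal.zero_rpow_of_pos (by norm_num)] at h
  refine h.congr fun F => ?_
  congr 1
  refine (tsum_subtype {i | i ∉ F} fun i => ‖A (e i)‖ₑ ^ 2).trans ?_
  congr 1
  funext i
  rw [sub_apply, ContinuousLinearMap.comp_apply, basisProj_basis, Set.indicator_apply]
  by_cases hi : i ∈ F <;> simp [hi]

/-- The truncation `∑_{i,j ∈ F} ⟨e_i, s e_j⟩ E_{ij}` of a trace-class operator `s`. -/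
noncomputable def truncate (e : HilbertBasis ι ℂ H) (F : Finset ι) (s : L1 H) : L1 H :=
  ∑ i ∈ F, ∑ j ∈ F, ⟪e i, s.toOp (e j)⟫_ℂ • elemMatrix e i j

theorem toOp_truncate (e : HilbertBasis ι ℂ H) (F : Finset ι) (s : L1 H) :
    (truncate e F s).toOp = basisProj e F ∘L s.toOp ∘L basisProj e F := by
  ext x
  simp only [truncate, elemMatrix, map_sum, map_smul, L1.toOp_ketbra, sum_apply, smul_apply,
    InnerProductSpace.rankOne_apply, ContinuousLinearMap.comp_apply, basisProj_apply,
    Finset.smul_sum, smul_smul]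
  rw [Finset.sum_comm]
  refine Finset.sum_congr rfl fun i _ => Finset.sum_congr rfl fun j _ => ?_
  rw [mul_comm]

/-- The truncations of a trace-class operator converge to it in the trace norm. Writing
`s = A* B` with `A`, `B` Hilbert–Schmidt, `s - P s P = (A - A P)* B + (A P)* (B - B P)`, and both
terms are controlled by Cauchy–Schwarz and the tails of `∑ ‖A e_i‖²` and `∑ ‖B e_i‖²`. -/
theorem tendsto_truncate (e : HilbertBasis ι ℂ H) (s : L1 H) :
    Tendsto (fun F => truncate e F s) atTop (𝓝 s) := by
  obtain ⟨A, B, hs, hA, hB⟩ := exists_eq_adjoint_comp_hs e s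
  rw [tendsto_iff_edist_tendsto_0]
  have hlim : Tendsto (fun F =>
      (∑' i, ‖(A - A ∘L basisProj e F) (e i)‖ₑ ^ 2) ^ (1 / 2 : ℝ) *
        (∑' i, ‖B (e i)‖ₑ ^ 2) ^ (1 / 2 : ℝ) +
      (∑' i, ‖A (e i)‖ₑ ^ 2) ^ (1 / 2 : ℝ) *
        (∑' i, ‖(B - B ∘L basisProj e F) (e i)‖ₑ ^ 2) ^ (1 / 2 : ℝ)) atTop (𝓝 0) := by
    have h1 := ENNReal.Tendsto.mul_const (tendsto_tsum_sub_comp_basisProj e A hA)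
      (Or.inr (ENNReal.rpow_ne_top_of_nonneg (by norm_num : (0 : ℝ) ≤ 1 / 2) hB))
    have h2 := ENNReal.Tendsto.const_mul (tendsto_tsum_sub_comp_basisProj e B hB)
      (Or.inr (ENNReal.rpow_ne_top_of_nonneg (by norm_num : (0 : ℝ) ≤ 1 / 2) hA))
    simpa using h1.add h2
  refine tendsto_of_tendsto_of_tendsto_of_le_of_le tendsto_const_nhds hlim
    (fun _ => zero_le) fun F => ?_
  have hdec : s.toOp - (truncate e F s).toOp =
      (A - A ∘L basisProj e F).adjoint ∘L B +
        (A ∘L basisProj e F).adjoint ∘L (B - B ∘L basisProj e F) := by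
    rw [toOp_truncate, hs, map_sub, ContinuousLinearMap.adjoint_comp, basisProj_adjoint]
    ext x
    simp
  calc edist (truncate e F s) s = traceNorm (s.toOp - (truncate e F s).toOp) := by
        rw [edist_comm, edist_eq_enorm_sub, L1.enorm_eq, map_sub]
    _ ≤ _ := by
        rw [hdec]
        refine (traceNorm_add_le _ _).trans (add_le_add (traceNorm_adjoint_comp_le e _ _)
          ((traceNorm_adjoint_comp_le e _ _).trans ?_))
        gcongr ?_ ^ _ * _
        exact tsum_comp_basisProj_le e F A

/-- A continuous functional on `L¹(H)` is the limit of its values on truncations. -/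
theorem tendsto_map_truncate {E : Type*} [NormedAddCommGroup E] [NormedSpace ℂ E]
    (e : HilbertBasis ι ℂ H) (φ : L1 H →L[ℂ] E) (s : L1 H) :
    Tendsto (fun F => ∑ i ∈ F, ∑ j ∈ F, ⟪e i, s.toOp (e j)⟫_ℂ • φ (elemMatrix e i j))
      atTop (𝓝 (φ s)) := by
  simpa [truncate, Function.comp_def] using (φ.continuous.tendsto s).comp (tendsto_truncate e s)

/-! ### Positivity of operator matrices -/

theorem isPositive_iff_inner_nonneg (T : H →L[ℂ] H) :
    T.IsPositive ↔ ∀ x, 0 ≤ ⟪x, T x⟫_ℂ := by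
  refine ⟨fun h => h.inner_nonneg_right, fun h => ?_⟩
  rw [ContinuousLinearMap.isPositive_iff_complex]
  intro x
  have hx : 0 ≤ ⟪T x, x⟫_ℂ := by
    rw [← inner_conj_symm]
    exact star_nonneg_iff.mpr (h x)
  rw [RCLike.nonneg_iff] at hx
  exact ⟨RCLike.conj_eq_iff_re.mp (RCLike.conj_eq_iff_im.mpr hx.2), hx.1⟩

/-- If the `a i` are isometries with mutually orthogonal ranges, then `∑ a i ∘ T i j ∘ (a j)*` is
positive if and only if the operator matrix `T i j` is. -/
theorem isPositive_sum_conj_iff {κ : Type*} [DecidableEq κ] (F : Finset κ) {a : κ → K →L[ℂ] H}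
    (ha : ∀ i j y, (a i).adjoint (a j y) = if i = j then y else 0) (T : κ → κ → K →L[ℂ] K) :
    (∑ i ∈ F, ∑ j ∈ F, a i ∘L T i j ∘L (a j).adjoint).IsPositive ↔
      ∀ y : κ → K, 0 ≤ ∑ i ∈ F, ∑ j ∈ F, ⟪y i, T i j (y j)⟫_ℂ := by
  have key : ∀ z, ⟪z, (∑ i ∈ F, ∑ j ∈ F, a i ∘L T i j ∘L (a j).adjoint) z⟫_ℂ =
      ∑ i ∈ F, ∑ j ∈ F, ⟪(a i).adjoint z, T i j ((a j).adjoint z)⟫_ℂ := by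
    intro z
    simp only [sum_apply, inner_sum, ContinuousLinearMap.comp_apply,
      ContinuousLinearMap.adjoint_inner_left]
  rw [isPositive_iff_inner_nonneg]
  refine ⟨fun h y => ?_, fun h z => (key z).symm ▸ h fun i => (a i).adjoint z⟩
  have hz : ∀ i ∈ F, (a i).adjoint (∑ k ∈ F, a k (y k)) = y i := by
    intro i hi
    simp [map_sum, ha, hi]
  have := h (∑ k ∈ F, a k (y k))
  rw [key] at this
  refine this.trans_eq (Finset.sum_congr rfl fun i hi => Finset.sum_congr rfl fun j hj => ?_)
  rw [hz i hi, hz j hj]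

theorem ketTensor_adjoint_ketTensor {κ : Type*} [DecidableEq κ] {v : κ → H}
    (hv : Orthonormal ℂ v) (i j : κ) (y : K) :
    (ketTensor K (v i)).adjoint (ketTensor K (v j) y) = if i = j then y else 0 := by
  rw [ketTensor_apply, ketTensor_adjoint_htmul, orthonormal_iff_ite.mp hv]
  split_ifs <;> simp

/-- `∑ |v_i⟩⟨v_j| ⊗ T i j` is positive if and only if the operator matrix `T i j` is. -/
theorem isPositive_sum_rankOneTensor_iff {κ : Type*} (F : Finset κ) {v : κ → H}
    (hv : Orthonormal ℂ v) (T : κ → κ → L1 K) :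
    (∑ i ∈ F, ∑ j ∈ F, rankOneTensor (v i) (v j) (T i j)).toOp.IsPositive ↔
      ∀ y : κ → K, 0 ≤ ∑ i ∈ F, ∑ j ∈ F, ⟪y i, (T i j).toOp (y j)⟫_ℂ := by
  classical
  rw [← isPositive_sum_conj_iff F (ketTensor_adjoint_ketTensor hv) fun i j => (T i j).toOp]
  simp only [map_sum, toOp_rankOneTensor, opTensor_rankOne]

theorem orthonormal_stdVec (n : ℕ) : Orthonormal ℂ (stdVec n) := by
  have h : stdVec n = EuclideanSpace.basisFun (Fin n) ℂ :=
    funext fun k => (EuclideanSpace.basisFun_apply _ _ k).symm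
  exact h ▸ (EuclideanSpace.basisFun (Fin n) ℂ).orthonormal

theorem isPositive_idTensor_iff (n : ℕ) (Φ : L1 H →ₗ[ℂ] L1 K)
    (S : L1 (HTensor (EuclideanSpace ℂ (Fin n)) H)) :
    (idTensor n Φ S).toOp.IsPositive ↔
      ∀ y : Fin n → K, 0 ≤ ∑ k, ∑ l, ⟪y k, (Φ (entry n k l S)).toOp (y l)⟫_ℂ := by
  rw [← isPositive_sum_rankOneTensor_iff Finset.univ (orthonormal_stdVec n)
    fun k l => Φ (entry n k l S)]
  simp [idTensor]

theorem isPositive_choiMatrix_iff (e : HilbertBasis ι ℂ H) (Φ : L1 H →ₗ[ℂ] L1 K)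
    (F : Finset ι) :
    (choiMatrix e Φ F).toOp.IsPositive ↔
      ∀ y : ι → K, 0 ≤ ∑ i ∈ F, ∑ j ∈ F, ⟪y i, (Φ (elemMatrix e i j)).toOp (y j)⟫_ℂ :=
  isPositive_sum_rankOneTensor_iff F e.orthonormal fun i j => Φ (elemMatrix e i j)

/-! ### Complete positivity and positive Choi matrices -/

/-- Complete positivity, tested on the rank one operator `|ψ⟩⟨ψ|` with `ψ = ∑ e_k ⊗ x_k`. -/
theorem IsCP.sum_inner_ketbra_nonneg {Φ : L1 H →ₗ[ℂ] L1 K} (hΦ : IsCP Φ) {n : ℕ}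
    (x : Fin n → H) (y : Fin n → K) :
    0 ≤ ∑ k, ∑ l, ⟪y k, (Φ (L1.ketbra (x k) (x l))).toOp (y l)⟫_ℂ := by
  have hS : (∑ k, ∑ l, rankOneTensor (stdVec n k) (stdVec n l)
      (L1.ketbra (x k) (x l))).toOp.IsPositive := by
    rw [isPositive_sum_rankOneTensor_iff Finset.univ (orthonormal_stdVec n)
      fun k l => L1.ketbra (x k) (x l)]
    intro z
    have h : ∑ k, ∑ l, ⟪z k, (L1.ketbra (x k) (x l)).toOp (z l)⟫_ℂ =
        star (∑ k, ⟪x k, z k⟫_ℂ) * ∑ l, ⟪x l, z l⟫_ℂ := by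
      simp only [star_sum, Finset.sum_mul_sum, L1.toOp_ketbra, InnerProductSpace.rankOne_apply,
        inner_smul_right]
      refine Finset.sum_congr rfl fun k _ => Finset.sum_congr rfl fun l _ => ?_
      rw [← inner_conj_symm (z k), mul_comm]
      rfl
    rw [h]
    exact star_mul_self_nonneg _
  have h := hΦ n _ hS
  simp only [map_sum, idTensor_rankOneTensor] at h
  have h' := isPositive_sum_rankOneTensor_iff Finset.univ (orthonormal_stdVec n)
    fun k l => Φ (L1.ketbra (x k) (x l))
  simp only [map_sum] at h'
  exact h'.mp h y

theorem IsCP.isPositive_choiMatrix (e : HilbertBasis ι ℂ H) {Φ : L1 H →ₗ[ℂ] L1 K}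
    (hΦ : IsCP Φ) (F : Finset ι) : (choiMatrix e Φ F).toOp.IsPositive := by
  rw [isPositive_choiMatrix_iff]
  intro y
  have h := hΦ.sum_inner_ketbra_nonneg (fun k => e (F.equivFin.symm k))
    fun k => y (F.equivFin.symm k)
  refine h.trans_eq ?_
  rw [← Finset.sum_coe_sort F, ← F.equivFin.symm.sum_comp]
  refine Finset.sum_congr rfl fun k _ => ?_
  rw [← Finset.sum_coe_sort F, ← F.equivFin.symm.sum_comp]
  rfl

theorem inner_entry (n : ℕ) (k l : Fin n) (S : L1 (HTensor (EuclideanSpace ℂ (Fin n)) H))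
    (x y : H) : ⟪x, (entry n k l S).toOp y⟫_ℂ =
      ⟪htmul (stdVec n k) x, S.toOp (htmul (stdVec n l) y)⟫_ℂ := by
  simp only [entry, L1.toOp_sandwich, ContinuousLinearMap.comp_apply,
    ContinuousLinearMap.adjoint_inner_right, ketTensor_apply]

theorem exists_adjoint_comp_self_of_isPositive {S : H →L[ℂ] H} (hS : S.IsPositive) :
    ∃ R : H →L[ℂ] H, ∀ x y, ⟪x, S y⟫_ℂ = ⟪R x, R y⟫_ℂ := by
  have h0 : 0 ≤ S := (ContinuousLinearMap.nonneg_iff_isPositive S).mpr hS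
  have h1 : (CFC.sqrt S).adjoint = CFC.sqrt S := (CFC.sqrt_nonneg S).isSelfAdjoint
  have h2 : CFC.sqrt S ∘L CFC.sqrt S = S := CFC.sqrt_mul_sqrt_self S h0
  refine ⟨CFC.sqrt S, fun x y => ?_⟩
  rw [← ContinuousLinearMap.adjoint_inner_right, h1]
  conv_lhs => rw [← h2]
  rfl

/-- If the Choi matrix on `F` is positive, then replacing each entry `S_{kl}` of a positive `S` by
its truncation to `F` and applying `Φ` gives a positive operator matrix. With `S = R*R` and an
orthonormal basis `b` of `ℂⁿ ⊗ H`, the coefficient `⟨e_i, S_{kl} e_j⟩` is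
`∑_m ⟨R (e_k ⊗ e_i), b_m⟩ ⟨b_m, R (e_l ⊗ e_j)⟩`, and each `m` contributes a value of the quadratic
form of the Choi matrix. -/
theorem sum_truncate_nonneg (e : HilbertBasis ι ℂ H) {Φ : L1 H →ₗ[ℂ] L1 K}
    {F : Finset ι} (hF : (choiMatrix e Φ F).toOp.IsPositive) {n : ℕ}
    {S : L1 (HTensor (EuclideanSpace ℂ (Fin n)) H)} (hS : S.toOp.IsPositive) (y : Fin n → K) :
    0 ≤ ∑ k, ∑ l, ∑ i ∈ F, ∑ j ∈ F, ⟪e i, (entry n k l S).toOp (e j)⟫_ℂ *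
      ⟪y k, (Φ (elemMatrix e i j)).toOp (y l)⟫_ℂ := by
  rw [isPositive_choiMatrix_iff] at hF
  obtain ⟨R, hR⟩ := exists_adjoint_comp_self_of_isPositive hS
  let b := stdBasis (HTensor (EuclideanSpace ℂ (Fin n)) H)
  let r : Fin n → ι → HTensor (EuclideanSpace ℂ (Fin n)) H :=
    fun k i => R (htmul (stdVec n k) (e i))
  have hsum : HasSum (fun m => ∑ k, ∑ l, ∑ i ∈ F, ∑ j ∈ F,
      (⟪r k i, b m⟫_ℂ * ⟪b m, r l j⟫_ℂ) * ⟪y k, (Φ (elemMatrix e i j)).toOp (y l)⟫_ℂ)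
      (∑ k, ∑ l, ∑ i ∈ F, ∑ j ∈ F, ⟪r k i, r l j⟫_ℂ *
        ⟪y k, (Φ (elemMatrix e i j)).toOp (y l)⟫_ℂ) :=
    hasSum_sum fun k _ => hasSum_sum fun l _ => hasSum_sum fun i _ => hasSum_sum fun j _ =>
      (b.hasSum_inner_mul_inner _ _).mul_right _
  simp only [inner_entry, hR]
  refine hsum.nonneg fun m => (hF fun i => ∑ k, ⟪b m, r k i⟫_ℂ • y k).trans_eq ?_
  simp only [map_sum, map_smul, inner_sum, sum_inner, inner_smul_left, inner_smul_right,
    inner_conj_symm, Finset.mul_sum]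
  -- Both sides are the same fourfold sum; reorder `k, l, i, j` to `i, j, l, k`.
  refine Eq.symm ((Finset.sum_congr rfl fun k _ => Finset.sum_comm).trans ?_)
  refine Finset.sum_comm.trans (Finset.sum_congr rfl fun i _ => ?_)
  refine (Finset.sum_congr rfl fun k _ => Finset.sum_comm).trans ?_
  refine Finset.sum_comm.trans (Finset.sum_congr rfl fun j _ => ?_)
  refine Finset.sum_comm.trans (Finset.sum_congr rfl fun l _ => Finset.sum_congr rfl fun k _ => ?_)
  ring

/-- If all Choi matrices of a trace-norm bounded map are positive, the map is completely positive:
the operator matrix `Φ (S_{kl})` is the limit of the positive ones obtained from the truncations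
of `S_{kl}`. -/
theorem isCP_of_isPositive_choiMatrix (e : HilbertBasis ι ℂ H) (Φ : L1 H →L[ℂ] L1 K)
    (hΦ : ∀ F : Finset ι, (choiMatrix e (Φ : L1 H →ₗ[ℂ] L1 K) F).toOp.IsPositive) :
    IsCP (Φ : L1 H →ₗ[ℂ] L1 K) := by
  intro n S hS
  rw [isPositive_idTensor_iff]
  intro y
  have hlim := tendsto_finsetSum Finset.univ fun k _ => tendsto_finsetSum Finset.univ fun l _ =>
    tendsto_map_truncate e ((matrixElementCLM (y k) (y l)).comp Φ) (entry n k l S)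
  exact ge_of_tendsto' hlim fun F => sum_truncate_nonneg e (hΦ F) hS y

/-! ### Trace preservation -/

theorem trace_ketbra (x y : H) : (L1.ketbra x y).trace = ⟪y, x⟫_ℂ := by
  have h := L1.hasSum_trace (stdBasis H) (L1.ketbra x y)
  simp only [L1.toOp_ketbra, InnerProductSpace.rankOne_apply, inner_smul_right] at h
  exact h.unique ((stdBasis H).hasSum_inner_mul_inner y x)

theorem trace_elemMatrix [DecidableEq ι] (e : HilbertBasis ι ℂ H) (i j : ι) :
    (elemMatrix e i j).trace = if i = j then 1 else 0 := by
  simp only [elemMatrix, trace_ketbra, orthonormal_iff_ite.mp e.orthonormal, eq_comm]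

/-- A trace-norm bounded map that preserves the trace of every elementary matrix preserves the
trace. -/
theorem trace_map_eq_of_elemMatrix (e : HilbertBasis ι ℂ H) (Φ : L1 H →L[ℂ] L1 K)
    (h : ∀ i j, (Φ (elemMatrix e i j)).trace = (elemMatrix e i j).trace) (s : L1 H) :
    (Φ s).trace = s.trace := by
  have h1 := tendsto_map_truncate e ((traceCLM K).comp Φ) s
  have h2 := tendsto_map_truncate e (traceCLM H) s
  simp only [ContinuousLinearMap.comp_apply, traceCLM_apply, h] at h1 h2
  exact tendsto_nhds_unique h1 h2

end ChoiJam

theorem mainTheorem6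
    {H₁ : Type*} [NormedAddCommGroup H₁] [InnerProductSpace ℂ H₁] [CompleteSpace H₁]
    {H₂ : Type*} [NormedAddCommGroup H₂] [InnerProductSpace ℂ H₂] [CompleteSpace H₂]
    {ι : Type*} [DecidableEq ι] (e : HilbertBasis ι ℂ H₁)
    (Φ : ChoiJam.L1 H₁ →L[ℂ] ChoiJam.L1 H₂) :
    (ChoiJam.IsCP (Φ : ChoiJam.L1 H₁ →ₗ[ℂ] ChoiJam.L1 H₂) ↔
      ∀ F : Finset ι, (ChoiJam.choiMatrix e
        (Φ : ChoiJam.L1 H₁ →ₗ[ℂ] ChoiJam.L1 H₂) F).toOp.IsPositive) ∧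
    (ChoiJam.IsCPTP (Φ : ChoiJam.L1 H₁ →ₗ[ℂ] ChoiJam.L1 H₂) ↔
      (∀ F : Finset ι, (ChoiJam.choiMatrix e
        (Φ : ChoiJam.L1 H₁ →ₗ[ℂ] ChoiJam.L1 H₂) F).toOp.IsPositive) ∧
      ∀ i j : ι, (Φ (ChoiJam.elemMatrix e i j)).trace = if i = j then 1 else 0) := by
  have hCP : ChoiJam.IsCP (Φ : ChoiJam.L1 H₁ →ₗ[ℂ] ChoiJam.L1 H₂) ↔
      ∀ F : Finset ι, (ChoiJam.choiMatrix e
        (Φ : ChoiJam.L1 H₁ →ₗ[ℂ] ChoiJam.L1 H₂) F).toOp.IsPositive :=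
    ⟨fun h F => h.isPositive_choiMatrix e F, ChoiJam.isCP_of_isPositive_choiMatrix e Φ⟩
  refine ⟨hCP, and_congr hCP ⟨fun h i j => ?_, fun h => ?_⟩⟩
  · exact (h _).trans (ChoiJam.trace_elemMatrix e i j)
  · exact ChoiJam.trace_map_eq_of_elemMatrix e Φ fun i j =>
      (h i j).trans (ChoiJam.trace_elemMatrix e i j).symm
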